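/- Let $a,b>0$, $1<p<5$, and let $V:\mathbb R^3\to\mathbb R$ be bounded and continuous with $\inf_{\mathbb R^3}V>0$. Let $k\ge 2$, let $a_1,\dots,a_k\in\mathbb R^3$ be pairwise distinct, and for each $i$ let $U^{(i)}\in H^1(\mathbb R^3)$ be a positive solution (unique up to translation; in particular, the unique positive radial solution) of $$-\Big(a+b\int_{\mathbb R^3}|\nabla u|^2\Big)\Delta u+V(a_i)u=u^p,\qquad u>0\quad\text{in }\mathbb R^3 .$$ Consider, for $\varepsilon>0$, $$-\Big(\varepsilon^2a+\varepsilon b\int_{\mathbb R^3}|\nabla u|^2\Big)\Delta u+V(x)u=u^p,\qquad u>0\quad\text{in }\mathbb R^3. \tag{1}$$ Solutions are positive weak solutions in $H^1(\mathbb R^3)$. Let $S\subset(0,\infty)$ have $0$ in its closure (for instance $S=(0,\varepsilon_0)$, or the set of terms of a sequence tending to $0$); all limits $\varepsilon\to0$ below are taken in $S$. A family $(u_\varepsilon)_{\varepsilon\in S}$ is called a $k$-peak solution of (1) if, for small $\varepsilon\in S$, $u_\varepsilon$ solves (1), and (i) for small $\varepsilon\in S$, $u_\varepsilon$ has $k$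 (distinct) local maximum points $y_\varepsilon^1,\dots,y_\varepsilon^k$, and each $y_\varepsilon^j$ converges to some point of $\mathbb R^3$ as $\varepsilon\to0$; (ii) for every $\tau>0$ there is $R>0$ such that, for small $\varepsilon\in S$, $|u_\varepsilon(x)|\le\tau$ for all $x\in\mathbb R^3\setminus\bigcup_{j}B_{R\varepsilon}(y_\varepsilon^j)$; (iii) there is $C>0$ such that $\int_{\mathbb R^3}(\varepsilon^2a|\nabla u_\varepsilon|^2+u_\varepsilon^2)\le C\varepsilon^3$ for small $\varepsilon\in S$. Write $\|u\|_\varepsilon^2=\int_{\mathbb R^3}(\varepsilon^2a|\nabla u|^2+V(x)u^2)$. Then (1) has no $k$-peak solution $(u_\varepsilon)_{\varepsilon\in S}$ of the form $$u_\varepsilon(x)=\sum_{i=1}^kU^{(i)}\Big(\frac{x-y_i}{\varepsilon}\Big)+\varphi_\varepsilon(x)\qquad\text{for small }\varepsilon\in S,$$ with $\varphi_\varepsilon\in H^1(\mathbb R^3)$, $\|\varphi_\varepsilon\|_\varepsilon=o(\varepsilon^{3/2})$, and points $y_i=y_i(\varepsilon)\to a_i$ as $\varepsilon\to0$ for each $i=1,\dots,k$.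 -/

import Mathlib

open MeasureTheory Filter Topology
open scoped ContDiff RealInnerProductSpace

noncomputable section

namespace Kirchhoff

/-- The Euclidean space `ℝ³`. -/
abbrev E3 : Type := EuclideanSpace ℝ (Fin 3)

/-- Real test functions on `ℝ³`: smooth with compact support. -/
def IsTest (ψ : E3 → ℝ) : Prop :=
  ContDiff ℝ ∞ ψ ∧ HasCompactSupport ψ

/-- `g` is the gradient of `u` in the sense of distributions:
`∫ u ∇ψ = - ∫ ψ g` (an identity in `ℝ³`) for every test function `ψ`. -/
def HasWeakGradient (u : E3 → ℝ) (g : E3 → E3) : Prop :=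
  LocallyIntegrable u ∧ LocallyIntegrable g ∧
    ∀ ψ : E3 → ℝ, IsTest ψ → ∫ x, u x • gradient ψ x = -∫ x, ψ x • g x

/-- The weak gradient is unique almost everywhere. -/
theorem HasWeakGradient.ae_eq {u : E3 → ℝ} {g h : E3 → E3}
    (hg : HasWeakGradient u g) (hh : HasWeakGradient u h) : g =ᵐ[volume] h := by
  refine ae_eq_of_integral_contDiff_smul_eq hg.2.1 hh.2.1 fun ψ h₁ h₂ => ?_
  have e₁ := hg.2.2 ψ ⟨h₁, h₂⟩
  have e₂ := hh.2.2 ψ ⟨h₁, h₂⟩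
  exact neg_injective (e₁.symm.trans e₂)

/-- The Sobolev space `H¹(ℝ³)`: `u` and its weak gradient are square integrable. -/
def MemH1 (u : E3 → ℝ) : Prop :=
  MemLp u 2 ∧ ∃ g : E3 → E3, MemLp g 2 ∧ HasWeakGradient u g

open Classical in
/-- The weak gradient of `u` (a representative; `0` if there is none). -/
def weakGrad (u : E3 → ℝ) : E3 → E3 :=
  if h : ∃ g : E3 → E3, HasWeakGradient u g then h.choose else 0

theorem HasWeakGradient.weakGrad_ae_eq {u : E3 → ℝ} {g : E3 → E3}
    (hg : HasWeakGradient u g) : weakGrad u =ᵐ[volume] g := by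
  have h : ∃ g : E3 → E3, HasWeakGradient u g := ⟨g, hg⟩
  have hw : weakGrad u = h.choose := dif_pos h
  rw [hw]
  exact h.choose_spec.ae_eq hg

/-- `u` is a positive (weak, finite energy) solution of
`-(ε² a + ε b ∫ |∇u|²) Δu + V u = u ^ p`, `u > 0` in `ℝ³`.
No regularity beyond `H¹` is required, so classical solutions in `H¹` are included. -/
structure IsPositiveSolution (a b p ε : ℝ) (V : E3 → ℝ) (u : E3 → ℝ) : Prop where
  memH1 : MemH1 u
  pos : ∀ᵐ x, 0 < u x
  eqn : ∀ ψ : E3 → ℝ, IsTest ψ →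
    (ε ^ 2 * a + ε * b * ∫ x, ‖weakGrad u x‖ ^ 2) * (∫ x, ⟪weakGrad u x, gradient ψ x⟫)
      + ∫ x, V x * u x * ψ x = ∫ x, u x ^ p * ψ x

/-- The norm `‖u‖_ε = (∫ (ε² a |∇u|² + V u²))^{1/2}` for `u ∈ H¹(ℝ³)`. -/
def epsNorm (a ε : ℝ) (V : E3 → ℝ) (u : E3 → ℝ) : ℝ :=
  √(∫ x, (ε ^ 2 * a * ‖weakGrad u x‖ ^ 2 + V x * u x ^ 2))

/-- `(u ε)`, `ε ∈ S`, is a family of `k`-peak solutions of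
`-(ε² a + ε b ∫ |∇u|²) Δu + V u = u ^ p`, `u > 0`, as `ε → 0` in `S`, where
`S ⊆ (0, ∞)` accumulates at `0`
(for example `S = (0, ε₀)`, or the set of values of a sequence tending to `0`). -/
structure IsMultiPeakSolution (k : ℕ) (a b p : ℝ) (V : E3 → ℝ) (S : Set ℝ)
    (u : ℝ → E3 → ℝ) : Prop where
  solution : ∀ᶠ ε in 𝓝[S] 0, IsPositiveSolution a b p ε V (u ε)
  /-- There are `k` local maximum points, each converging to some point of `ℝ³`, away from which
  `u ε` is small. -/
  peaks : ∃ (y : ℝ → Fin k → E3) (c : Fin k → E3),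
    (∀ᶠ ε in 𝓝[S] 0, Function.Injective (y ε) ∧ ∀ j, IsLocalMax (u ε) (y ε j)) ∧
    (∀ j, Tendsto (fun ε => y ε j) (𝓝[S] 0) (𝓝 (c j))) ∧
    (∀ τ > 0, ∃ R > 0, ∀ᶠ ε in 𝓝[S] 0,
      ∀ x, (∀ j, x ∉ Metric.ball (y ε j) (R * ε)) → |u ε x| ≤ τ)
  energy : ∃ C > 0, ∀ᶠ ε in 𝓝[S] 0,
    ∫ x, (ε ^ 2 * a * ‖weakGrad (u ε) x‖ ^ 2 + u ε x ^ 2) ≤ C * ε ^ 3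

/-- `u ε = ∑ᵢ U⁽ⁱ⁾((x - yᵢ)/ε) + φ_ε` with `φ_ε ∈ H¹(ℝ³)`, `‖φ_ε‖_ε = o(ε^{3/2})` and
`yᵢ = yᵢ(ε) → pt i` as `ε → 0` in `S`. -/
def HasPeakForm {k : ℕ} (a : ℝ) (V : E3 → ℝ) (S : Set ℝ) (pt : Fin k → E3)
    (U : Fin k → E3 → ℝ) (u : ℝ → E3 → ℝ) : Prop :=
  ∃ (y : ℝ → Fin k → E3) (φ : ℝ → E3 → ℝ),
    (∀ᶠ ε in 𝓝[S] 0, ∀ᵐ x, u ε x = (∑ i, U i (ε⁻¹ • (x - y ε i))) + φ ε x) ∧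
    (∀ᶠ ε in 𝓝[S] 0, MemH1 (φ ε)) ∧
    (fun ε => epsNorm a ε V (φ ε)) =o[𝓝[S] 0] (fun ε => ε ^ (3 / 2 : ℝ)) ∧
    (∀ i, Tendsto (fun ε => y ε i) (𝓝[S] 0) (𝓝 (pt i)))

end Kirchhoff

end

/-!
Suppose that `(u ε)` is such a family, and look at it from the `i`-th centre at scale `ε`:
`v z = u ε (ε z + yᵢ)`. This function solves the equation with `ε = 1` and potential
`V (ε z + yᵢ)` (`IsPositiveSolution.rescale`). The coefficient `a + b ∫ |∇v|²` is nonlocal: up to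
scaling it is the energy of `u ε` on the whole space, so it does not depend on `i`, and it feels
all the peaks at once. The limit profile `U i`, in contrast, solves an equation whose coefficient
contains its own energy only. The two are incompatible as soon as there is a second peak.

* Locally `v` converges to `U i`, in `L⁶` and with gradients in `L²` (`tendsto_profile`): the other
  profiles are translated to infinity (`tendsto_eLpNorm_translate`), and the remainder is
  small in `H¹`. Convergence in `L⁶` is what makes the nonlinear term converge; it comes from
  Sobolev's inequality for the weak gradient (`IsH1Grad.eLpNorm_six_le`), obtained by mollification
  from the Gagliardo–Nirenberg–Sobolev inequality for smooth compactly supported functions.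
* All the local terms of the weak equation therefore converge, and the equation can be solved for
  the energy: `∫ |∇v|² → ∫ |∇U i|²` (`tendsto_energy`). This uses a test function `ψ` with
  `∫ ∇U i · ∇ψ ≠ 0`. One exists, since otherwise `V(pt i) U i = (U i) ^ p`, so that `U i` would be
  a positive constant, which is not in `L²` (`IsPositiveSolution.exists_integral_inner_ne_zero`).
* Balls of rescaled radius `R` around two different centres are eventually disjoint
  (`eventually_local_energy_add_le`), so `∫_{B_R} |∇U i|² + ∫_{B_R} |∇U j|² ≤ ∫ |∇U i|²`
  for every `R`. Letting `R → ∞` gives `∇U j = 0`, which is excluded in the same way.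
-/

namespace Kirchhoff

open scoped ENNReal NNReal

/-! ### Affine changes of variables and the calculus of weak gradients -/

theorem affine_measurableEmbedding {ε : ℝ} (hε : 0 < ε) (y : E3) :
    MeasurableEmbedding (fun z : E3 => ε • z + y) :=
  ((Homeomorph.smulOfNeZero ε hε.ne').trans (Homeomorph.addRight y)).measurableEmbedding

theorem map_affine {ε : ℝ} (hε : 0 < ε) (y : E3) :
    Measure.map (fun z : E3 => ε • z + y) volume = ENNReal.ofReal ((ε ^ 3)⁻¹) • volume := by
  have h : (fun z : E3 => ε • z + y) = (fun z => z + y) ∘ (fun z => ε • z) := rfl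
  rw [h, ← Measure.map_map (by fun_prop) (by fun_prop), Measure.map_addHaar_smul _ hε.ne',
    Measure.map_smul, map_add_right_eq_self, finrank_euclideanSpace_fin, abs_of_pos (by positivity)]

theorem integral_comp_affine {F : Type*} [NormedAddCommGroup F] [NormedSpace ℝ F]
    {ε : ℝ} (hε : 0 < ε) (y : E3) (f : E3 → F) :
    ∫ z, f (ε • z + y) = (ε ^ 3)⁻¹ • ∫ x, f x := by
  rw [← (affine_measurableEmbedding hε y).integral_map, map_affine hε, integral_smul_measure,
    ENNReal.toReal_ofReal (by positivity)]

theorem ae_comp_affine {ε : ℝ} (hε : 0 < ε) (y : E3) {P : E3 → Prop} (h : ∀ᵐ x, P x) :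
    ∀ᵐ z : E3, P (ε • z + y) := by
  have : ∀ᵐ x ∂Measure.map (fun z : E3 => ε • z + y) volume, P x := by
    rw [map_affine hε]
    exact Measure.ae_smul_measure h _
  exact ae_of_ae_map (affine_measurableEmbedding hε y).measurable.aemeasurable this

theorem memLp_comp_affine {F : Type*} [NormedAddCommGroup F] {q : ℝ≥0∞}
    {ε : ℝ} (hε : 0 < ε) (y : E3) {f : E3 → F} (h : MemLp f q) :
    MemLp (fun z => f (ε • z + y)) q := by
  have : MemLp f q (Measure.map (fun z : E3 => ε • z + y) volume) := by
    rw [map_affine hε]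
    exact h.smul_measure ENNReal.ofReal_ne_top
  exact (memLp_map_measure_iff this.1
    (affine_measurableEmbedding hε y).measurable.aemeasurable).1 this

theorem IsTest.integrable {ψ : E3 → ℝ} (h : IsTest ψ) : Integrable ψ :=
  h.1.continuous.integrable_of_hasCompactSupport h.2

theorem IsTest.hasGradientAt {ψ : E3 → ℝ} (h : IsTest ψ) (x : E3) :
    HasGradientAt ψ (gradient ψ x) x :=
  ((h.1.differentiable (by simp)) x).hasGradientAt

theorem IsTest.continuous_gradient {ψ : E3 → ℝ} (h : IsTest ψ) : Continuous (gradient ψ) :=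
  (InnerProductSpace.toDual ℝ E3).symm.continuous.comp (h.1.continuous_fderiv (by simp))

theorem IsTest.hasCompactSupport_gradient {ψ : E3 → ℝ} (h : IsTest ψ) :
    HasCompactSupport (gradient ψ) :=
  (h.2.fderiv (𝕜 := ℝ)).comp_left (g := (InnerProductSpace.toDual ℝ E3).symm) (map_zero _)

/-- The test function that becomes `ψ` in the coordinate `z`, where `x = ε z + y`. -/
theorem IsTest.comp_affine_symm {ψ : E3 → ℝ} (h : IsTest ψ) {ε : ℝ} (hε : 0 < ε) (y : E3) :
    IsTest (fun x => ψ (ε⁻¹ • (x - y))) := by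
  refine ⟨h.1.comp (by fun_prop), ?_⟩
  exact h.2.comp_homeomorph
    ((Homeomorph.subRight y).trans (Homeomorph.smulOfNeZero ε⁻¹ (inv_ne_zero hε.ne')))

theorem IsTest.gradient_comp_affine_symm {ψ : E3 → ℝ} (h : IsTest ψ) {ε : ℝ} (y x : E3) :
    gradient (fun x => ψ (ε⁻¹ • (x - y))) x = ε⁻¹ • gradient ψ (ε⁻¹ • (x - y)) := by
  apply HasGradientAt.gradient
  have h1 := (h.hasGradientAt (ε⁻¹ • (x - y))).hasFDerivAt
  have h2 : HasFDerivAt (fun x : E3 => ε⁻¹ • (x - y)) (ε⁻¹ • ContinuousLinearMap.id ℝ E3) x :=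
    ((hasFDerivAt_id x).sub_const y).const_smul ε⁻¹
  rw [hasGradientAt_iff_hasFDerivAt]
  refine (h1.comp x h2).congr_fderiv ?_
  ext v
  simp

/-- `u ∈ H¹(ℝ³)`, and `g` is a representative of its weak gradient. -/
structure IsH1Grad (u : E3 → ℝ) (g : E3 → E3) : Prop where
  memLp : MemLp u 2
  memLp_grad : MemLp g 2
  eqn : ∀ ψ : E3 → ℝ, IsTest ψ → ∫ x, u x • gradient ψ x = -∫ x, ψ x • g x

theorem IsH1Grad.hasWeakGradient {u : E3 → ℝ} {g : E3 → E3} (h : IsH1Grad u g) :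
    HasWeakGradient u g :=
  ⟨h.memLp.locallyIntegrable one_le_two, h.memLp_grad.locallyIntegrable one_le_two, h.eqn⟩

theorem IsH1Grad.weakGrad_ae_eq {u : E3 → ℝ} {g : E3 → E3} (h : IsH1Grad u g) :
    weakGrad u =ᵐ[volume] g := h.hasWeakGradient.weakGrad_ae_eq

theorem IsH1Grad.congr {u v : E3 → ℝ} {g h : E3 → E3} (hu : IsH1Grad u g)
    (huv : u =ᵐ[volume] v) (hgh : g =ᵐ[volume] h) : IsH1Grad v h := by
  refine ⟨hu.memLp.ae_eq huv, hu.memLp_grad.ae_eq hgh, fun ψ hψ => ?_⟩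
  have e1 : ∫ x, v x • gradient ψ x = ∫ x, u x • gradient ψ x :=
    integral_congr_ae (huv.mono fun x hx => by simp only [hx])
  have e2 : ∫ x, ψ x • h x = ∫ x, ψ x • g x :=
    integral_congr_ae (hgh.mono fun x hx => by simp only [hx])
  rw [e1, e2, hu.eqn ψ hψ]

theorem MemH1.isH1Grad {u : E3 → ℝ} (h : MemH1 u) : IsH1Grad u (weakGrad u) := by
  obtain ⟨h2, g, hg, hw⟩ := h
  exact IsH1Grad.congr ⟨h2, hg, hw.2.2⟩ .rfl hw.weakGrad_ae_eq.symm

theorem IsH1Grad.add {u v : E3 → ℝ} {g h : E3 → E3} (hu : IsH1Grad u g) (hv : IsH1Grad v h) :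
    IsH1Grad (fun x => u x + v x) (fun x => g x + h x) := by
  refine ⟨hu.memLp.add hv.memLp, hu.memLp_grad.add hv.memLp_grad, fun ψ hψ => ?_⟩
  have i1 : ∀ {w : E3 → ℝ} {k : E3 → E3}, IsH1Grad w k →
      Integrable (fun x => w x • gradient ψ x) := fun hw =>
    hw.hasWeakGradient.1.integrable_smul_right_of_hasCompactSupport hψ.continuous_gradient
      hψ.hasCompactSupport_gradient
  have i2 : ∀ {w : E3 → ℝ} {k : E3 → E3}, IsH1Grad w k →
      Integrable (fun x => ψ x • k x) := fun hw =>
    hw.hasWeakGradient.2.1.integrable_smul_left_of_hasCompactSupport hψ.1.continuous hψ.2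
  simp only [add_smul, smul_add]
  rw [integral_add (i1 hu) (i1 hv), integral_add (i2 hu) (i2 hv), hu.eqn ψ hψ, hv.eqn ψ hψ, neg_add]

theorem IsH1Grad.sum {ι : Type*} (s : Finset ι) {u : ι → E3 → ℝ} {g : ι → E3 → E3}
    (h : ∀ i ∈ s, IsH1Grad (u i) (g i)) :
    IsH1Grad (fun x => ∑ i ∈ s, u i x) (fun x => ∑ i ∈ s, g i x) := by
  classical
  induction s using Finset.induction_on with
  | empty => exact ⟨by simp, by simp, by simp⟩
  | insert i s hi ih =>
    simp only [Finset.sum_insert hi]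
    exact (h i (by simp)).add (ih fun j hj => h j (by simp [hj]))

theorem IsH1Grad.comp_affine {u : E3 → ℝ} {g : E3 → E3} (h : IsH1Grad u g) {ε : ℝ} (hε : 0 < ε)
    (y : E3) : IsH1Grad (fun z => u (ε • z + y)) (fun z => ε • g (ε • z + y)) := by
  refine ⟨memLp_comp_affine hε y h.memLp, (memLp_comp_affine hε y h.memLp_grad).const_smul ε,
    fun ψ hψ => ?_⟩
  have key := h.eqn _ (hψ.comp_affine_symm hε y)
  have e : ∀ z : E3, ε⁻¹ • (ε • z + y - y) = z := fun z => by
    rw [add_sub_cancel_right, smul_smul, inv_mul_cancel₀ hε.ne', one_smul]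
  have e1 := integral_comp_affine hε y
    (fun x => u x • gradient (fun x => ψ (ε⁻¹ • (x - y))) x)
  have e2 := integral_comp_affine hε y (fun x => ψ (ε⁻¹ • (x - y)) • g x)
  simp only [hψ.gradient_comp_affine_symm, e] at e1 e2 key
  have : ∫ z, u (ε • z + y) • gradient ψ z = ε • ∫ z, u (ε • z + y) • ε⁻¹ • gradient ψ z := by
    rw [← integral_smul]
    congr 1; ext1 z
    rw [smul_comm ε, smul_smul ε, mul_inv_cancel₀ hε.ne', one_smul]
  rw [this, e1, key]
  simp only [smul_comm _ ε, integral_smul, e2, smul_neg]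

/-! ### Sobolev's inequality in `H¹(ℝ³)` -/

/-- **Young's inequality** for averages: convolution with a probability density is a contraction
of `L²`, by Jensen's inequality and Tonelli's theorem. -/
theorem eLpNorm_convolution_le {F : Type*} [NormedAddCommGroup F] [NormedSpace ℝ F]
    {ρ : E3 → ℝ} (hρc : Continuous ρ) (hρ0 : ∀ x, 0 ≤ ρ x) (hρi : Integrable ρ)
    (hρ1 : ∫ x, ρ x = 1) {g : E3 → F} (hg : AEStronglyMeasurable g) :
    eLpNorm (fun x => ∫ t, ρ t • g (x - t)) 2 ≤ eLpNorm g 2 := by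
  set ν : Measure E3 := volume.withDensity (fun t => ENNReal.ofReal (ρ t)) with hν
  have hprob : IsProbabilityMeasure ν := ⟨by
    rw [hν, withDensity_apply _ .univ, Measure.restrict_univ,
      ← ofReal_integral_eq_lintegral_ofReal hρi (Eventually.of_forall hρ0), hρ1,
      ENNReal.ofReal_one]⟩
  have hac : ν ≪ volume := withDensity_absolutelyContinuous _ _
  have hint : ∀ x, ∫ t, ρ t • g (x - t) = ∫ t, g (x - t) ∂ν := fun x => by
    rw [hν, integral_withDensity_eq_integral_toReal_smul (by fun_prop) (by simp)]
    simp only [ENNReal.toReal_ofReal (hρ0 _)]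
  have hmeas : AEStronglyMeasurable (fun z : E3 × E3 => g (z.1 - z.2)) (volume.prod ν) :=
    (hg.comp_quasiMeasurePreserving (quasiMeasurePreserving_sub _ _)).mono_ac
      (Measure.AbsolutelyContinuous.rfl.prod hac)
  have hmx : ∀ x, AEStronglyMeasurable (fun t => g (x - t)) ν := fun x =>
    (hg.comp_quasiMeasurePreserving
      (quasiMeasurePreserving_sub_left volume x)).mono_ac hac
  -- Jensen's inequality for the probability measure `ν` with density `ρ`
  have hpt : ∀ x, ‖∫ t, ρ t • g (x - t)‖ₑ ^ (2 : ℝ) ≤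
      ∫⁻ t, ‖g (x - t)‖ₑ ^ (2 : ℝ) ∂ν := fun x => by
    have h2 := eLpNorm_nnreal_pow_eq_lintegral (μ := ν) (f := fun t => g (x - t)) (p := 2) two_ne_zero
    simp only [NNReal.coe_ofNat, ENNReal.coe_ofNat] at h2
    rw [hint, ← h2]
    gcongr
    calc _ ≤ ∫⁻ t, ‖g (x - t)‖ₑ ∂ν := enorm_integral_le_lintegral_enorm _
      _ = eLpNorm (fun t => g (x - t)) 1 ν := eLpNorm_one_eq_lintegral_enorm.symm
      _ ≤ _ := eLpNorm_le_eLpNorm_of_exponent_le one_le_two (hmx x)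
  rw [← ENNReal.rpow_le_rpow_iff (two_pos : (0 : ℝ) < 2)]
  have h1 := eLpNorm_nnreal_pow_eq_lintegral (μ := volume)
    (f := fun x => ∫ t, ρ t • g (x - t)) (p := 2) two_ne_zero
  have h2 := eLpNorm_nnreal_pow_eq_lintegral (μ := volume) (f := g) (p := 2) two_ne_zero
  simp only [NNReal.coe_ofNat, ENNReal.coe_ofNat] at h1 h2
  rw [h1, h2]
  calc _ ≤ ∫⁻ x, ∫⁻ t, ‖g (x - t)‖ₑ ^ (2 : ℝ) ∂ν := lintegral_mono hpt
    _ = ∫⁻ t, (∫⁻ x, ‖g (x - t)‖ₑ ^ (2 : ℝ)) ∂ν :=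
        lintegral_lintegral_swap (f := fun x t => ‖g (x - t)‖ₑ ^ (2 : ℝ)) (hmeas.enorm.pow_const _)
    _ = ∫⁻ t, (∫⁻ x, ‖g x‖ₑ ^ (2 : ℝ)) ∂ν := by
        congr 1; ext1 t
        exact lintegral_sub_right_eq_self (μ := volume) (fun x => ‖g x‖ₑ ^ (2 : ℝ)) t
    _ = _ := by simp

/-- The Sobolev constant of the embedding `H¹(ℝ³) ⊆ L⁶(ℝ³)`. -/
noncomputable def sobolevConst : ℝ≥0 := SNormLESNormFDerivOfEqConst ℝ (volume : Measure E3) 2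

theorem eLpNorm_le_of_compactSupport {w : E3 → ℝ} (hw : ContDiff ℝ 1 w)
    (hc : HasCompactSupport w) : eLpNorm w 6 ≤ sobolevConst * eLpNorm (fderiv ℝ w) 2 := by
  have := eLpNorm_le_eLpNorm_fderiv_of_eq (F := ℝ) (volume : Measure E3) hw hc (p := 2) (p' := 6)
    (by norm_num) (by simp) (by simp; norm_num)
  exact_mod_cast this

/-- Cutoffs `χ n`, each the dilation by `n + 1` of one bump function: they are eventually `1` at
each point, and their derivatives are `O(1 / n)` uniformly in space. -/
theorem exists_cutoff : ∃ (χ : ℕ → E3 → ℝ) (M : ℝ≥0), (∀ n, ContDiff ℝ 1 (χ n)) ∧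
    (∀ n, HasCompactSupport (χ n)) ∧ (∀ n x, ‖χ n x‖ ≤ 1) ∧
    (∀ n x, ‖fderiv ℝ (χ n) x‖ ≤ M / ((n : ℝ) + 1)) ∧
    ∀ x, ∀ᶠ n in atTop, χ n x = 1 := by
  let χ : ContDiffBump (0 : E3) := ⟨1, 2, one_pos, one_lt_two⟩
  obtain ⟨M, hM⟩ := (χ.hasCompactSupport.fderiv (𝕜 := ℝ)).exists_bound_of_continuous
    ((χ.contDiff (n := 1)).continuous_fderiv one_ne_zero)
  have hM0 : 0 ≤ M := (norm_nonneg _).trans (hM 0)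
  refine ⟨fun n x => χ (((n : ℝ) + 1)⁻¹ • x), ⟨M, hM0⟩, fun n => χ.contDiff.comp (by fun_prop),
    fun n => χ.hasCompactSupport.comp_homeomorph
      (Homeomorph.smulOfNeZero ((n : ℝ) + 1)⁻¹ (by positivity)), fun n x => ?_, fun n x => ?_,
    fun x => ?_⟩
  · rw [Real.norm_of_nonneg χ.nonneg]; exact χ.le_one
  · have h1 := ((χ.contDiff (n := 1)).differentiable one_ne_zero (((n : ℝ) + 1)⁻¹ • x)).hasFDerivAt
    have h2 : HasFDerivAt (fun x : E3 => ((n : ℝ) + 1)⁻¹ • x)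
      (((n : ℝ) + 1)⁻¹ • ContinuousLinearMap.id ℝ E3) x :=
      (hasFDerivAt_id (𝕜 := ℝ) x).const_smul (((n : ℝ) + 1)⁻¹)
    have h3 := (h1.comp x h2).fderiv
    rw [Function.comp_def] at h3
    rw [h3, ContinuousLinearMap.comp_smul, ContinuousLinearMap.comp_id, norm_smul,
      norm_inv, Real.norm_of_nonneg (by positivity : (0 : ℝ) ≤ (n : ℝ) + 1), div_eq_inv_mul]
    gcongr
    exact hM _
  · obtain ⟨N, hN⟩ := exists_nat_ge ‖x‖
    filter_upwards [eventually_ge_atTop N] with n hn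
    apply χ.one_of_mem_closedBall
    rw [mem_closedBall_zero_iff, norm_smul, norm_inv,
      Real.norm_of_nonneg (by positivity : (0 : ℝ) ≤ (n : ℝ) + 1)]
    change _ ≤ (1 : ℝ)
    rw [inv_mul_le_one₀ (by positivity)]
    have : (N : ℝ) ≤ n := by exact_mod_cast hn
    linarith

/-- Sobolev's inequality for `C¹` functions in `L²`, whatever their support: apply the compactly
supported case to cutoffs and use Fatou's lemma. -/
theorem eLpNorm_six_le_of_contDiff {w : E3 → ℝ} (hw : ContDiff ℝ 1 w) (h2 : MemLp w 2) :
    eLpNorm w 6 ≤ sobolevConst * eLpNorm (fderiv ℝ w) 2 := by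
  obtain ⟨χ, M, hχ, hχc, hχ1, hχd, hχl⟩ := exists_cutoff
  have hlim : ∀ᵐ x : E3, Tendsto (fun n => χ n x * w x) atTop (𝓝 (w x)) :=
    Eventually.of_forall fun x => tendsto_const_nhds.congr'
      ((hχl x).mono fun n hn => by simp only [hn, one_mul])
  refine (Lp.eLpNorm_lim_le_liminf_eLpNorm
    (fun n => ((hχ n).mul hw).continuous.aestronglyMeasurable) w hlim).trans ?_
  have hb : ∀ n : ℕ, eLpNorm (fun x => χ n x * w x) 6 ≤ sobolevConst * (eLpNorm (fderiv ℝ w) 2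
      + ENNReal.ofReal (M / ((n : ℝ) + 1)) * eLpNorm w 2) := fun n => by
    refine (eLpNorm_le_of_compactSupport ((hχ n).mul hw) (hχc n).mul_right).trans ?_
    gcongr
    have hd : fderiv ℝ (fun x => χ n x * w x) =
        (fun x => χ n x • fderiv ℝ w x) + (fun x => w x • fderiv ℝ (χ n) x) := by
      ext1 x
      exact fderiv_fun_mul ((hχ n).differentiable one_ne_zero x) (hw.differentiable one_ne_zero x)
    rw [hd]
    have hcw := hw.continuous_fderiv one_ne_zero
    have hcχ := (hχ n).continuous_fderiv one_ne_zero
    refine (eLpNorm_add_le ((hχ n).continuous.smul hcw).aestronglyMeasurable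
      (hw.continuous.smul hcχ).aestronglyMeasurable one_le_two).trans (add_le_add ?_ ?_)
    · refine eLpNorm_mono fun x => ?_
      change ‖χ n x • fderiv ℝ w x‖ ≤ _
      rw [norm_smul]
      exact mul_le_of_le_one_left (norm_nonneg _) (hχ1 n x)
    · refine eLpNorm_le_mul_eLpNorm_of_ae_le_mul (Eventually.of_forall fun x => ?_) 2
      change ‖w x • fderiv ℝ (χ n) x‖ ≤ _
      rw [norm_smul, mul_comm]
      gcongr
      exact hχd n x
  have ht : Tendsto (fun n : ℕ => (sobolevConst : ℝ≥0∞) * (eLpNorm (fderiv ℝ w) 2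
      + ENNReal.ofReal (M / ((n : ℝ) + 1)) * eLpNorm w 2)) atTop
      (𝓝 (sobolevConst * (eLpNorm (fderiv ℝ w) 2 + ENNReal.ofReal 0 * eLpNorm w 2))) := by
    refine ENNReal.Tendsto.const_mul (tendsto_const_nhds.add (ENNReal.Tendsto.mul_const
      (ENNReal.tendsto_ofReal ?_) (Or.inr h2.eLpNorm_ne_top))) (Or.inr ENNReal.coe_ne_top)
    exact tendsto_const_nhds.div_atTop (tendsto_natCast_atTop_atTop.atTop_add tendsto_const_nhds)
  calc _ ≤ _ := liminf_le_liminf (Eventually.of_forall hb)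
    _ = _ := ht.liminf_eq
    _ = _ := by simp

theorem norm_gradient (w : E3 → ℝ) (x : E3) : ‖gradient w x‖ = ‖fderiv ℝ w x‖ :=
  (InnerProductSpace.toDual ℝ E3).symm.norm_map _

/-- A mollified `H¹` function is smooth and its gradient is the mollified weak gradient. -/
theorem IsH1Grad.gradient_convolution {u : E3 → ℝ} {g : E3 → E3} (h : IsH1Grad u g)
    {ρ : E3 → ℝ} (hρ : IsTest ρ) :
    ContDiff ℝ 1 (fun x => ∫ t, ρ t • u (x - t)) ∧
    ∀ x, gradient (fun x => ∫ t, ρ t • u (x - t)) x = ∫ t, ρ t • g (x - t) := by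
  have hloc := h.hasWeakGradient.1
  have hρ1 : ContDiff ℝ 1 ρ := hρ.1.of_le (by simp)
  refine ⟨hρ.2.contDiff_convolution_left (ContinuousLinearMap.lsmul ℝ ℝ) (n := 1) hρ1 hloc,
    fun x => ?_⟩
  have hd := hρ.2.hasFDerivAt_convolution_left (ContinuousLinearMap.lsmul ℝ ℝ) hρ1 hloc x
  have hψ : IsTest (fun t => ρ (x - t)) :=
    ⟨hρ.1.comp (by fun_prop), hρ.2.comp_homeomorph (Homeomorph.subLeft x)⟩
  have hgψ : ∀ t, gradient (fun t => ρ (x - t)) t = - gradient ρ (x - t) := fun t => by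
    apply HasGradientAt.gradient
    rw [hasGradientAt_iff_hasFDerivAt]
    have h2 : HasFDerivAt (fun t : E3 => x - t) (-ContinuousLinearMap.id ℝ E3) t :=
      (hasFDerivAt_id t).const_sub x
    refine ((hρ.hasGradientAt (x - t)).hasFDerivAt.comp t h2).congr_fderiv ?_
    ext v
    simp
  have key := h.eqn _ hψ
  simp only [hgψ, smul_neg, integral_neg, neg_inj] at key
  apply HasGradientAt.gradient
  rw [hasGradientAt_iff_hasFDerivAt]
  refine hd.congr_fderiv ?_
  have hswap : ∫ t, ρ t • g (x - t) = ∫ t, ρ (x - t) • g t := by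
    rw [← integral_sub_left_eq_self _ volume x]
    simp
  rw [hswap, ← key, convolution_eq_swap]
  have hint : Integrable (fun t => u t • gradient ρ (x - t)) := by
    have := hloc.integrable_smul_right_of_hasCompactSupport hψ.continuous_gradient
      hψ.hasCompactSupport_gradient
    simpa [hgψ] using this
  have hL := (InnerProductSpace.toDual ℝ E3).toContinuousLinearEquiv.toContinuousLinearMap
    |>.integral_comp_comm hint
  change ∫ t, (InnerProductSpace.toDual ℝ E3) (u t • gradient ρ (x - t)) =
    (InnerProductSpace.toDual ℝ E3) _ at hL
  rw [← hL]
  congr 1; ext1 t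
  ext v
  have := (hρ.hasGradientAt (x - t)).hasFDerivAt.fderiv
  rw [ContinuousLinearMap.precompL_apply]
  simp only [this]
  rw [map_smul]
  change (InnerProductSpace.toDual ℝ E3 (gradient ρ (x - t)) v) * u t =
    u t * (InnerProductSpace.toDual ℝ E3 (gradient ρ (x - t)) v)
  ring

/-- **Sobolev's inequality** in `H¹(ℝ³)`, from the one for smooth functions by mollification. -/
theorem IsH1Grad.eLpNorm_six_le {u : E3 → ℝ} {g : E3 → E3} (h : IsH1Grad u g) :
    eLpNorm u 6 ≤ sobolevConst * eLpNorm g 2 := by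
  let φ : ℕ → ContDiffBump (0 : E3) := fun n =>
    ⟨((n : ℝ) + 1)⁻¹, 2 * ((n : ℝ) + 1)⁻¹, by positivity, by
      have : (0 : ℝ) < ((n : ℝ) + 1)⁻¹ := by positivity
      linarith⟩
  have hφ : Tendsto (fun n => (φ n).rOut) atTop (𝓝 0) := by
    have : Tendsto (fun n : ℕ => 2 * ((n : ℝ) + 1)⁻¹) atTop (𝓝 (2 * 0)) :=
      (tendsto_inv_atTop_zero.comp
        (tendsto_natCast_atTop_atTop.atTop_add tendsto_const_nhds)).const_mul 2
    simpa using this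
  have hlim := ContDiffBump.ae_convolution_tendsto_right_of_locallyIntegrable (K := 2) hφ
    (Eventually.of_forall fun n => le_rfl) h.hasWeakGradient.1
  have hρ : ∀ n, IsTest ((φ n).normed volume) := fun n =>
    ⟨(φ n).contDiff_normed, (φ n).hasCompactSupport_normed⟩
  have hY : ∀ {F : Type} [NormedAddCommGroup F] [NormedSpace ℝ F] (n : ℕ) {f : E3 → F},
      MemLp f 2 → eLpNorm (fun x => ∫ t, (φ n).normed volume t • f (x - t)) 2 ≤ eLpNorm f 2 :=
    fun n _ hf => eLpNorm_convolution_le (φ n).continuous_normed (φ n).nonneg_normed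
      (hρ n).integrable (φ n).integral_normed hf.1
  have hC := fun n => h.gradient_convolution (hρ n)
  refine (Lp.eLpNorm_lim_le_liminf_eLpNorm
    (fun n => (hC n).1.continuous.aestronglyMeasurable) u hlim).trans ?_
  refine (liminf_le_liminf (v := fun _ => sobolevConst * eLpNorm g 2)
    (Eventually.of_forall fun n => ?_)).trans (by simp)
  refine (eLpNorm_six_le_of_contDiff (hC n).1 ⟨(hC n).1.continuous.aestronglyMeasurable,
    (hY n h.memLp).trans_lt h.memLp.2⟩).trans ?_
  gcongr
  refine (eLpNorm_congr_norm_ae (Eventually.of_forall fun x => ?_)).trans_le (hY n h.memLp_grad)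
  rw [← norm_gradient, (hC n).2]

theorem IsH1Grad.memLp_six {u : E3 → ℝ} {g : E3 → E3} (h : IsH1Grad u g) : MemLp u 6 :=
  ⟨h.memLp.1, h.eLpNorm_six_le.trans_lt
    (ENNReal.mul_lt_top ENNReal.coe_lt_top h.memLp_grad.2)⟩

/-! ### Convergence in `L^q` and separating profiles -/

theorem abs_rpow_sub_rpow_le {x y p : ℝ} (hx : 0 ≤ x) (hy : 0 ≤ y) (hp : 1 ≤ p) :
    |x ^ p - y ^ p| ≤ p * |x - y| * (x + y) ^ (p - 1) := by
  wlog hyx : y ≤ x generalizing x y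
  · rw [abs_sub_comm, abs_sub_comm x, add_comm x]
    exact this hy hx (not_le.1 hyx).le
  rcases hx.eq_or_lt with rfl | hx'
  · have : y = 0 := le_antisymm hyx hy
    simp [this]
  rw [abs_of_nonneg (sub_nonneg.2 (Real.rpow_le_rpow hy hyx (by linarith))),
    abs_of_nonneg (sub_nonneg.2 hyx)]
  have hb := one_add_mul_self_le_rpow_one_add (s := (y - x) / x) (p := p)
    (by rw [le_div_iff₀ hx']; linarith) hp
  have e : 1 + (y - x) / x = y / x := by field_simp; ring
  rw [e, Real.div_rpow hy hx, le_div_iff₀ (Real.rpow_pos_of_pos hx' p)] at hb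
  have hxp : x ^ p = x * x ^ (p - 1) := by
    rw [← Real.rpow_one_add' hx (by linarith)]; congr 1; ring
  have h3 : (1 + p * ((y - x) / x)) * x ^ p = x ^ p - p * (x - y) * x ^ (p - 1) := by
    rw [hxp]; field_simp; ring
  have h4 : x ^ (p - 1) ≤ (x + y) ^ (p - 1) :=
    Real.rpow_le_rpow hx (by linarith) (by linarith)
  have h5 : p * (x - y) * x ^ (p - 1) ≤ p * (x - y) * (x + y) ^ (p - 1) :=
    mul_le_mul_of_nonneg_left h4 (mul_nonneg (by linarith) (sub_nonneg.2 hyx))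
  linarith

/-- The map `f ↦ ‖f‖ ^ p` is continuous from `L^p` to `L¹`. -/
theorem tendsto_eLpNorm_norm_rpow_sub {α ι G : Type*} [MeasurableSpace α] [NormedAddCommGroup G]
    {μ : Measure α} {l : Filter ι} {p : ℝ} (hp : 1 < p) {f : ι → α → G} {F : α → G}
    (hf : ∀ᶠ i in l, AEStronglyMeasurable (f i) μ) (hF : MemLp F (ENNReal.ofReal p) μ)
    (h : Tendsto (fun i => eLpNorm (fun x => f i x - F x) (ENNReal.ofReal p) μ) l (𝓝 0)) :
    Tendsto (fun i => eLpNorm (fun x => ‖f i x‖ ^ p - ‖F x‖ ^ p) 1 μ) l (𝓝 0) := by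
  set P := ENNReal.ofReal p
  have hconj : p.HolderConjugate (p / (p - 1)) := Real.HolderConjugate.conjExponent hp
  have hHT : ENNReal.HolderTriple P (ENNReal.ofReal (p / (p - 1))) 1 := hconj.ennrealOfReal
  have hP1 : 1 ≤ P := by simpa [P] using hp.le
  have hPe : ENNReal.ofReal (p / (p - 1)) * ENNReal.ofReal (p - 1) = P := by
    rw [← ENNReal.ofReal_mul hconj.symm.nonneg, div_mul_cancel₀ _ (by linarith)]
  -- Hölder's inequality applied to `p * ‖f - F‖ * (‖f‖ + ‖F‖) ^ (p - 1)`
  have hbound : ∀ᶠ i in l, eLpNorm (fun x => ‖f i x‖ ^ p - ‖F x‖ ^ p) 1 μ ≤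
      ENNReal.ofReal p * (eLpNorm (fun x => f i x - F x) P μ *
        (1 + 2 * eLpNorm F P μ) ^ (p - 1)) := by
    have hev : ∀ᶠ i in l, eLpNorm (fun x => f i x - F x) P μ ≤ 1 :=
      h.eventually_le_const one_pos
    filter_upwards [hf, hev] with i hfm hi
    set m : α → ℝ := fun x => ‖f i x‖ + ‖F x‖ with hm
    have hmm : AEStronglyMeasurable m μ := hfm.norm.add hF.1.norm
    have hd : AEStronglyMeasurable (fun x => f i x - F x) μ := hfm.sub hF.1
    have hmp : eLpNorm (fun x => ‖m x‖ ^ (p - 1)) (ENNReal.ofReal (p / (p - 1))) μ ≤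
        (1 + 2 * eLpNorm F P μ) ^ (p - 1) := by
      rw [eLpNorm_norm_rpow _ (by linarith), hPe]
      refine ENNReal.rpow_le_rpow ?_ (by linarith)
      calc eLpNorm m P μ ≤ eLpNorm (fun x => ‖f i x‖) P μ + eLpNorm (fun x => ‖F x‖) P μ :=
            eLpNorm_add_le hfm.norm hF.1.norm hP1
        _ = eLpNorm (fun x => (f i x - F x) + F x) P μ + eLpNorm F P μ := by
            simp [eLpNorm_norm]
        _ ≤ (eLpNorm (fun x => f i x - F x) P μ + eLpNorm F P μ) + eLpNorm F P μ := by
            gcongr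
            exact eLpNorm_add_le hd hF.1 hP1
        _ ≤ _ := by rw [two_mul, ← add_assoc]; gcongr
    have hmeas : AEStronglyMeasurable (fun x => ‖m x‖ ^ (p - 1)) μ :=
      (hmm.norm.aemeasurable.pow_const _).aestronglyMeasurable
    calc eLpNorm (fun x => ‖f i x‖ ^ p - ‖F x‖ ^ p) 1 μ
        ≤ ENNReal.ofReal p * eLpNorm
            ((fun x => ‖f i x - F x‖) • (fun x => ‖m x‖ ^ (p - 1))) 1 μ := by
          refine eLpNorm_le_mul_eLpNorm_of_ae_le_mul (Eventually.of_forall fun x => ?_) 1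
          have h1 := abs_rpow_sub_rpow_le (norm_nonneg (f i x)) (norm_nonneg (F x)) hp.le
          have h2 : |‖f i x‖ - ‖F x‖| ≤ ‖f i x - F x‖ := abs_norm_sub_norm_le _ _
          have h3 : 0 ≤ m x := by positivity
          have h4 : 0 ≤ m x ^ (p - 1) := Real.rpow_nonneg h3 _
          change |_| ≤ p * ‖‖f i x - F x‖ * ‖m x‖ ^ (p - 1)‖
          rw [norm_mul, norm_norm, Real.norm_of_nonneg h3, Real.norm_of_nonneg h4, ← mul_assoc]
          refine h1.trans (mul_le_mul_of_nonneg_right ?_ h4)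
          exact mul_le_mul_of_nonneg_left h2 (by linarith)
      _ ≤ ENNReal.ofReal p * (eLpNorm (fun x => ‖f i x - F x‖) P μ *
            eLpNorm (fun x => ‖m x‖ ^ (p - 1)) (ENNReal.ofReal (p / (p - 1))) μ) := by
          gcongr
          exact eLpNorm_smul_le_mul_eLpNorm hmeas hd.norm
      _ ≤ _ := by
          rw [eLpNorm_norm]
          gcongr
  have hfin : (1 + 2 * eLpNorm F P μ) ^ (p - 1) ≠ ⊤ :=
    ENNReal.rpow_ne_top_of_nonneg (by linarith)
      (ENNReal.add_ne_top.2 ⟨ENNReal.one_ne_top, ENNReal.mul_ne_top ENNReal.ofNat_ne_top hF.2.ne⟩)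
  refine tendsto_of_tendsto_of_tendsto_of_le_of_le' tendsto_const_nhds ?_
    (Eventually.of_forall fun _ => zero_le) hbound
  have := ENNReal.Tendsto.const_mul (a := ENNReal.ofReal p)
    (ENNReal.Tendsto.mul_const (b := (1 + 2 * eLpNorm F P μ) ^ (p - 1)) h (Or.inr hfin))
    (Or.inr ENNReal.ofReal_ne_top)
  simpa using this

/-- On a finite measure space, `L^q`-convergence implies `L^p`-convergence for `p ≤ q`. -/
theorem tendsto_eLpNorm_of_exponent_le {α ι G : Type*} [MeasurableSpace α] [NormedAddCommGroup G]
    {μ : Measure α} [IsFiniteMeasure μ] {l : Filter ι} {p q : ℝ≥0∞} (hp : p ≠ 0) (hpq : p ≤ q)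
    {f : ι → α → G} (hf : ∀ᶠ i in l, AEStronglyMeasurable (f i) μ)
    (h : Tendsto (fun i => eLpNorm (f i) q μ) l (𝓝 0)) :
    Tendsto (fun i => eLpNorm (f i) p μ) l (𝓝 0) := by
  rcases eq_or_ne p ⊤ with rfl | hpt
  · rwa [top_le_iff.1 hpq] at h
  refine tendsto_of_tendsto_of_tendsto_of_le_of_le' tendsto_const_nhds ?_
    (Eventually.of_forall fun _ => zero_le)
    (hf.mono fun i hi => eLpNorm_le_eLpNorm_mul_rpow_measure_univ hpq hi)
  have hexp : 0 ≤ 1 / p.toReal - 1 / q.toReal := by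
    rcases eq_or_ne q ⊤ with rfl | hqt
    · simp
    · exact sub_nonneg.2 (one_div_le_one_div_of_le (ENNReal.toReal_pos hp hpt)
        (ENNReal.toReal_mono hqt hpq))
  simpa using ENNReal.Tendsto.mul_const h
    (Or.inr (ENNReal.rpow_ne_top_of_nonneg hexp (measure_ne_top μ Set.univ)))

/-- Passage to the limit in a pairing: the second factor converges in `L¹`, the first one
pointwise and boundedly. -/
theorem tendsto_integral_inner {α ι G : Type*} [MeasurableSpace α] [NormedAddCommGroup G]
    [InnerProductSpace ℝ G] {μ : Measure α} {l : Filter ι} [l.IsCountablyGenerated]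
    {f w : ι → α → G} {F w₀ : α → G} {C : ℝ}
    (hf : ∀ᶠ i in l, AEStronglyMeasurable (f i) μ) (hF : Integrable F μ)
    (h : Tendsto (fun i => eLpNorm (fun x => f i x - F x) 1 μ) l (𝓝 0))
    (hw : ∀ᶠ i in l, AEStronglyMeasurable (w i) μ) (hC : ∀ᶠ i in l, ∀ x, ‖w i x‖ ≤ C)
    (hlim : ∀ x, Tendsto (fun i => w i x) l (𝓝 (w₀ x))) :
    Tendsto (fun i => ∫ x, ⟪f i x, w i x⟫ ∂μ) l (𝓝 (∫ x, ⟪F x, w₀ x⟫ ∂μ)) := by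
  have h1 : Tendsto (fun i => ∫ x, ⟪F x, w i x⟫ ∂μ) l (𝓝 (∫ x, ⟪F x, w₀ x⟫ ∂μ)) := by
    refine tendsto_integral_filter_of_dominated_convergence (fun x => ‖F x‖ * C)
      (hw.mono fun i hi => hF.1.inner hi) (hC.mono fun i hi => Eventually.of_forall fun x => ?_)
      (hF.norm.mul_const C) (Eventually.of_forall fun x => tendsto_const_nhds.inner (hlim x))
    exact (norm_inner_le_norm _ _).trans (mul_le_mul_of_nonneg_left (hi x) (norm_nonneg _))
  have h2 : Tendsto (fun i => C * (eLpNorm (fun x => f i x - F x) 1 μ).toReal) l (𝓝 0) := by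
    simpa using ((ENNReal.tendsto_toReal ENNReal.zero_ne_top).comp h).const_mul C
  refine (tendsto_iff_of_dist (squeeze_zero' (Eventually.of_forall fun _ => dist_nonneg)
    ?_ h2)).1 h1
  filter_upwards [hf, hw, hC, h.eventually_lt_const ENNReal.zero_lt_top] with i hfi hwi hCi hlt
  have hdi : Integrable (fun x => f i x - F x) μ := memLp_one_iff_integrable.1 ⟨hfi.sub hF.1, hlt⟩
  have hpair : ∀ {g : α → G}, Integrable g μ → Integrable (fun x => ⟪g x, w i x⟫) μ := fun hg =>
    (hg.norm.mul_const C).mono' (hg.1.inner hwi) (Eventually.of_forall fun x =>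
      (norm_inner_le_norm _ _).trans (mul_le_mul_of_nonneg_left (hCi x) (norm_nonneg _)))
  have hfint : Integrable (f i) μ := (hdi.add hF).congr (Eventually.of_forall fun x => by simp)
  rw [dist_comm, dist_eq_norm, ← integral_sub (hpair hfint) (hpair hF)]
  simp only [← inner_sub_left]
  calc _ ≤ ∫ x, ‖f i x - F x‖ * C ∂μ :=
        norm_integral_le_of_norm_le (hdi.norm.mul_const C) (Eventually.of_forall fun x =>
          (norm_inner_le_norm _ _).trans (mul_le_mul_of_nonneg_left (hCi x) (norm_nonneg _)))
    _ = _ := by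
        rw [integral_mul_const, eLpNorm_one_eq_lintegral_enorm, mul_comm,
          ← integral_norm_eq_lintegral_enorm hdi.1]

/-- A translate of an `L^q` function that runs off to infinity disappears from every ball. -/
theorem tendsto_eLpNorm_translate {ι G : Type*} [NormedAddCommGroup G] [NormedSpace ℝ G]
    {l : Filter ι} {q : ℝ≥0∞} (hq : q ≠ ⊤) {F : E3 → G} (hF : MemLp F q) {s : ι → E3}
    (hs : Tendsto s l (Bornology.cobounded E3)) (R : ℝ) :
    Tendsto (fun i => eLpNorm (fun z => F (z + s i)) q (volume.restrict (Metric.ball 0 R))) l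
      (𝓝 0) := by
  rw [ENNReal.tendsto_nhds_zero]
  intro δ hδ
  obtain ⟨c, hc, hcδ, hcc, -⟩ := hF.exists_hasCompactSupport_eLpNorm_sub_le hq hδ.ne'
  obtain ⟨R', hR'⟩ := hc.isCompact.isBounded.subset_closedBall 0
  filter_upwards [(tendsto_norm_cobounded_atTop.comp hs).eventually_gt_atTop (R + R')] with i hi
  have heq : (fun z => F (z + s i)) =ᵐ[volume.restrict (Metric.ball 0 R)]
      (F - c) ∘ (fun z => z + s i) := by
    refine (ae_restrict_mem Metric.isOpen_ball.measurableSet).mono fun z hz => ?_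
    have hz' : c (z + s i) = 0 := by
      by_contra hne
      have h1 := hR' (subset_tsupport c hne)
      rw [mem_closedBall_zero_iff] at h1
      rw [mem_ball_zero_iff] at hz
      have h2 : ‖s i‖ ≤ ‖z + s i‖ + ‖z‖ := by
        simpa using norm_sub_le (z + s i) z
      simp only [Function.comp_apply] at hi
      linarith
    simp [hz']
  rw [eLpNorm_congr_ae heq]
  refine (eLpNorm_mono_measure _ Measure.restrict_le_self).trans ?_
  rw [eLpNorm_comp_measurePreserving (hF.1.sub hcc.aestronglyMeasurable)
    (measurePreserving_add_right volume (s i))]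
  exact hcδ

/-- In a sum of profiles whose centres separate, plus a vanishing remainder, only the `i`-th
profile is visible from its own centre. -/
theorem tendsto_eLpNorm_sub_profile {k : ℕ} {ι G : Type*} [NormedAddCommGroup G] [NormedSpace ℝ G]
    {l : Filter ι} {q : ℝ≥0∞} (hq1 : 1 ≤ q) (hq : q ≠ ⊤) {F : Fin k → E3 → G}
    (hF : ∀ j, MemLp (F j) q) {s : Fin k → ι → E3} {i : Fin k} (hsi : ∀ e, s i e = 0)
    (hs : ∀ j ≠ i, Tendsto (s j) l (Bornology.cobounded E3)) {f r : ι → E3 → G}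
    (hrm : ∀ᶠ e in l, AEStronglyMeasurable (r e))
    (hr : Tendsto (fun e => eLpNorm (r e) q) l (𝓝 0))
    (hf : ∀ᶠ e in l, f e =ᵐ[volume] fun z => (∑ j, F j (z + s j e)) + r e z) (R : ℝ) :
    Tendsto (fun e => eLpNorm (fun z => f e z - F i z) q (volume.restrict (Metric.ball 0 R))) l
      (𝓝 0) := by
  classical
  set μ := (volume : Measure E3).restrict (Metric.ball 0 R)
  have hlim : Tendsto (fun e => (∑ j ∈ Finset.univ.erase i, eLpNorm (fun z => F j (z + s j e)) q μ)
      + eLpNorm (r e) q) l (𝓝 0) := by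
    have h := (tendsto_finsetSum (Finset.univ.erase i) fun j hj =>
      tendsto_eLpNorm_translate hq (hF j) (hs j (Finset.ne_of_mem_erase hj)) R).add hr
    simpa using h
  refine tendsto_of_tendsto_of_tendsto_of_le_of_le' tendsto_const_nhds hlim
    (Eventually.of_forall fun _ => zero_le) ?_
  filter_upwards [hrm, hf] with e hre hfe
  have hm : ∀ j, AEStronglyMeasurable (fun z => F j (z + s j e)) μ := fun j =>
    ((hF j).1.comp_measurePreserving (measurePreserving_add_right volume (s j e))).mono_measure
      Measure.restrict_le_self
  have heq : (fun z => f e z - F i z) =ᵐ[μ]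
      (∑ j ∈ Finset.univ.erase i, fun z => F j (z + s j e)) + r e := by
    refine (ae_restrict_of_ae hfe).mono fun z hz => ?_
    simp only [hz, Pi.add_apply, Finset.sum_apply]
    rw [← Finset.add_sum_erase _ _ (Finset.mem_univ i), hsi, add_zero]
    abel
  rw [eLpNorm_congr_ae heq]
  refine (eLpNorm_add_le (Finset.aestronglyMeasurable_sum _ fun j _ => hm j)
    (hre.mono_measure Measure.restrict_le_self) hq1).trans (add_le_add ?_ ?_)
  · exact eLpNorm_sum_le (fun j _ => hm j) hq1
  · exact eLpNorm_mono_measure _ Measure.restrict_le_self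

/-! ### Rescaled solutions and their energy -/

theorem real_inner_eq_mul (x y : ℝ) : ⟪x, y⟫ = x * y := by simp [mul_comm]

theorem MemH1.weakGrad_rescale {u : E3 → ℝ} (h : MemH1 u) {ε : ℝ} (hε : 0 < ε) (y : E3) :
    weakGrad (fun z => u (ε • z + y)) =ᵐ[volume] fun z => ε • weakGrad u (ε • z + y) :=
  (h.isH1Grad.comp_affine hε y).weakGrad_ae_eq

theorem MemH1.setIntegral_weakGrad_rescale {u : E3 → ℝ} (h : MemH1 u) {ε : ℝ} (hε : 0 < ε)
    (y : E3) (R : ℝ) : ∫ z in Metric.ball 0 R, ‖weakGrad (fun z => u (ε • z + y)) z‖ ^ 2 =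
      ε⁻¹ * ∫ x in Metric.ball y (ε * R), ‖weakGrad u x‖ ^ 2 := by
  rw [← integral_indicator Metric.isOpen_ball.measurableSet,
    ← integral_indicator Metric.isOpen_ball.measurableSet]
  have h1 := integral_comp_affine hε y
    ((Metric.ball y (ε * R)).indicator fun x => ‖weakGrad u x‖ ^ 2)
  have h2 : ∫ z, (Metric.ball (0 : E3) R).indicator
      (fun z => ‖weakGrad (fun z => u (ε • z + y)) z‖ ^ 2) z = ∫ z, ε ^ 2 *
      (Metric.ball y (ε * R)).indicator (fun x => ‖weakGrad u x‖ ^ 2) (ε • z + y) := by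
    refine integral_congr_ae ((h.weakGrad_rescale hε y).mono fun z hz => ?_)
    have hmem : ε • z + y ∈ Metric.ball y (ε * R) ↔ z ∈ Metric.ball (0 : E3) R := by
      rw [mem_ball_iff_norm, mem_ball_zero_iff, add_sub_cancel_right, norm_smul,
        Real.norm_of_nonneg hε.le, mul_lt_mul_iff_right₀ hε]
    by_cases hzR : z ∈ Metric.ball (0 : E3) R
    · simp only [Set.indicator_of_mem hzR, Set.indicator_of_mem (hmem.2 hzR), hz, norm_smul,
        Real.norm_of_nonneg hε.le, mul_pow]
    · simp only [Set.indicator_of_notMem hzR, Set.indicator_of_notMem (mt hmem.1 hzR), mul_zero]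
  rw [h2, integral_const_mul, h1, smul_eq_mul, ← mul_assoc]
  congr 1
  field_simp

theorem MemH1.integral_weakGrad_rescale {u : E3 → ℝ} (h : MemH1 u) {ε : ℝ} (hε : 0 < ε)
    (y : E3) : ∫ z, ‖weakGrad (fun z => u (ε • z + y)) z‖ ^ 2 =
      ε⁻¹ * ∫ x, ‖weakGrad u x‖ ^ 2 := by
  have h1 := integral_comp_affine hε y (fun x => ‖weakGrad u x‖ ^ 2)
  rw [integral_congr_ae ((h.weakGrad_rescale hε y).mono fun z hz => by rw [hz])]
  simp only [norm_smul, Real.norm_of_nonneg hε.le, mul_pow, integral_const_mul, h1, smul_eq_mul,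
    ← mul_assoc]
  congr 1
  field_simp

theorem MemH1.integrable_weakGrad_sq {u : E3 → ℝ} (h : MemH1 u) :
    Integrable (fun x => ‖weakGrad u x‖ ^ 2) :=
  h.isH1Grad.memLp_grad.integrable_norm_pow two_ne_zero

/-- In the coordinate `z` with `x = ε z + y`, the singularly perturbed equation becomes the one
with `ε = 1` and potential `V (ε z + y)`. -/
theorem IsPositiveSolution.rescale {a b p ε : ℝ} {V u : E3 → ℝ}
    (h : IsPositiveSolution a b p ε V u) (hε : 0 < ε) (y : E3) :
    IsPositiveSolution a b p 1 (fun z => V (ε • z + y)) (fun z => u (ε • z + y)) := by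
  have hH := h.memH1.isH1Grad.comp_affine hε y
  refine ⟨⟨hH.memLp, _, hH.memLp_grad, hH.hasWeakGradient⟩, ae_comp_affine hε y h.pos,
    fun ψ hψ => ?_⟩
  have e : ∀ z : E3, ε⁻¹ • (ε • z + y - y) = z := fun z => by
    rw [add_sub_cancel_right, smul_smul, inv_mul_cancel₀ hε.ne', one_smul]
  have key := h.eqn _ (hψ.comp_affine_symm hε y)
  have e1 := integral_comp_affine hε y
    (fun x => ⟪weakGrad u x, gradient (fun x => ψ (ε⁻¹ • (x - y))) x⟫)
  have e2 := integral_comp_affine hε y (fun x => V x * u x * ψ (ε⁻¹ • (x - y)))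
  have e3 := integral_comp_affine hε y (fun x => u x ^ p * ψ (ε⁻¹ • (x - y)))
  simp only [hψ.gradient_comp_affine_symm, e, smul_eq_mul] at e1 e2 e3 key
  have e4 : ∫ z, ⟪weakGrad (fun z => u (ε • z + y)) z, gradient ψ z⟫ =
      ε ^ 2 * ∫ z, ⟪weakGrad u (ε • z + y), ε⁻¹ • gradient ψ z⟫ := by
    rw [← integral_const_mul]
    refine integral_congr_ae ((h.memH1.weakGrad_rescale hε y).mono fun z hz => ?_)
    simp only [hz, inner_smul_left, inner_smul_right, RCLike.conj_to_real]
    field_simp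
  rw [h.memH1.integral_weakGrad_rescale hε y, e4, e1, e2, e3, ← key]
  field_simp

/-- The nonlinearity is locally integrable, since `u ∈ L⁶` by Sobolev's inequality. -/
theorem MemH1.locallyIntegrable_rpow {u : E3 → ℝ} (h : MemH1 u) (hpos : ∀ᵐ x, 0 < u x)
    {p : ℝ} (hp : 1 < p) (hp6 : p ≤ 6) : LocallyIntegrable (fun x => u x ^ p) := by
  rw [locallyIntegrable_iff]
  intro K hK
  have : IsFiniteMeasure ((volume : Measure E3).restrict K) := ⟨by simpa using hK.measure_lt_top⟩
  have h6 : MemLp u (ENNReal.ofReal p) (volume.restrict K) :=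
    (h.isH1Grad.memLp_six.restrict K).mono_exponent
      (ENNReal.ofReal_le_of_le_toReal (by simpa using hp6))
  have hi := h6.integrable_norm_rpow (by simp; linarith) ENNReal.ofReal_ne_top
  rw [ENNReal.toReal_ofReal (by linarith)] at hi
  refine hi.congr ((ae_restrict_of_ae hpos).mono fun x hx => ?_)
  simp only [Real.norm_of_nonneg hx.le]

/-- The weak gradient of a positive solution of the autonomous problem does not annihilate all
gradients of test functions: otherwise the equation reduces to `c u = u ^ p`, so that `u` is a
positive constant, which is not square integrable. -/
theorem IsPositiveSolution.exists_integral_inner_ne_zero {a b p c : ℝ} {U : E3 → ℝ}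
    (h : IsPositiveSolution a b p 1 (fun _ => c) U) (hc : 0 < c) (hp : 1 < p) (hp6 : p ≤ 6) :
    ∃ ψ, IsTest ψ ∧ ∫ x, ⟪weakGrad U x, gradient ψ x⟫ ≠ 0 := by
  by_contra! hcon
  have hl1 : LocallyIntegrable (fun x => c * U x) :=
    (h.memH1.isH1Grad.hasWeakGradient.1).smul c
  have hl2 := h.memH1.locallyIntegrable_rpow h.pos hp hp6
  have hz : ∀ᵐ x, c * U x = U x ^ p := by
    refine ae_eq_of_integral_contDiff_smul_eq hl1 hl2 fun ψ h₁ h₂ => ?_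
    have := h.eqn ψ ⟨h₁, h₂⟩
    rw [hcon ψ ⟨h₁, h₂⟩, mul_zero, zero_add] at this
    simpa only [smul_eq_mul, mul_comm (ψ _)] using this
  have hconst : U =ᵐ[volume] fun _ => c ^ (p - 1)⁻¹ := by
    filter_upwards [hz, h.pos] with x hx hpos
    have h1 : U x ^ (p - 1) = c := by
      rw [Real.rpow_sub_one hpos.ne', ← hx, mul_div_cancel_right₀ _ hpos.ne']
    rw [← h1, Real.rpow_rpow_inv hpos.le (by linarith)]
  have hmem := h.memH1.1.ae_eq hconst
  rw [memLp_const_iff two_ne_zero ENNReal.ofNat_ne_top] at hmem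
  rcases hmem with h0 | h0
  · exact (Real.rpow_pos_of_pos hc _).ne' h0
  · simp at h0

/-- If rescaled solutions converge locally (in `L⁶`, with gradients in `L²`) to a solution of the
limit problem, then the Dirichlet energies converge too, since the energy is the only nonlocal
coefficient in the equation. -/
theorem tendsto_energy {ι : Type*} {l : Filter ι} [l.IsCountablyGenerated]
    {a b p c M : ℝ} (hb : 0 < b) (hp : 1 < p) (hp6 : p ≤ 6) (hc : 0 < c)
    {U : E3 → ℝ} (hU : IsPositiveSolution a b p 1 (fun _ => c) U)
    {V v : ι → E3 → ℝ} (hv : ∀ᶠ e in l, IsPositiveSolution a b p 1 (V e) (v e))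
    (hVc : ∀ e, Continuous (V e)) (hVM : ∀ e x, |V e x| ≤ M)
    (hVl : ∀ x, Tendsto (fun e => V e x) l (𝓝 c))
    (h6 : ∀ R, Tendsto (fun e => eLpNorm (fun z => v e z - U z) 6
      (volume.restrict (Metric.ball 0 R))) l (𝓝 0))
    (h2 : ∀ R, Tendsto (fun e => eLpNorm (fun z => weakGrad (v e) z - weakGrad U z) 2
      (volume.restrict (Metric.ball 0 R))) l (𝓝 0)) :
    Tendsto (fun e => ∫ x, ‖weakGrad (v e) x‖ ^ 2) l (𝓝 (∫ x, ‖weakGrad U x‖ ^ 2)) := by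
  obtain ⟨ψ, hψ, hne⟩ := hU.exists_integral_inner_ne_zero hc hp hp6
  obtain ⟨R, hR⟩ := hψ.2.isCompact.isBounded.subset_ball 0
  set μ := (volume : Measure E3).restrict (Metric.ball 0 R) with hμ
  have : IsFiniteMeasure μ := ⟨by
    rw [hμ, Measure.restrict_apply_univ]
    exact measure_ball_lt_top⟩
  obtain ⟨C₀, hC₀⟩ := hψ.2.exists_bound_of_continuous hψ.1.continuous
  obtain ⟨C₁, hC₁⟩ := hψ.hasCompactSupport_gradient.exists_bound_of_continuous
    hψ.continuous_gradient
  have hψ0 : ∀ x ∉ Metric.ball (0 : E3) R, ψ x = 0 := fun x hx => by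
    by_contra hne
    exact hx (hR (subset_tsupport ψ hne))
  have hgψ0 : ∀ x ∉ Metric.ball (0 : E3) R, gradient ψ x = 0 := fun x hx => by
    have : fderiv ℝ ψ x = 0 := by
      by_contra hne
      exact hx (hR (support_fderiv_subset ℝ hne))
    rw [gradient, this, map_zero]
  have hvm : ∀ᶠ e in l, AEStronglyMeasurable (v e) μ := hv.mono fun e he =>
    he.memH1.1.1.restrict
  have hgm : ∀ᶠ e in l, AEStronglyMeasurable (weakGrad (v e)) μ := hv.mono fun e he =>
    he.memH1.isH1Grad.memLp_grad.1.restrict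
  have hU6 : MemLp U 6 μ := hU.memH1.isH1Grad.memLp_six.restrict _
  have hG2 : MemLp (weakGrad U) 2 μ := hU.memH1.isH1Grad.memLp_grad.restrict _
  have hvUm : ∀ᶠ e in l, AEStronglyMeasurable (fun z => v e z - U z) μ :=
    hvm.mono fun e he => he.sub hU6.1
  have hgGm : ∀ᶠ e in l, AEStronglyMeasurable (fun z => weakGrad (v e) z - weakGrad U z) μ :=
    hgm.mono fun e he => he.sub hG2.1
  have hp6' : ENNReal.ofReal p ≤ 6 := ENNReal.ofReal_le_of_le_toReal (by simpa using hp6)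
  -- the gradient term
  have hI : Tendsto (fun e => ∫ x, ⟪weakGrad (v e) x, gradient ψ x⟫) l
      (𝓝 (∫ x, ⟪weakGrad U x, gradient ψ x⟫)) := by
    have := tendsto_integral_inner (w := fun _ : ι => gradient ψ) (w₀ := gradient ψ) (C := C₁)
      hgm (hG2.integrable one_le_two)
      (tendsto_eLpNorm_of_exponent_le one_ne_zero one_le_two hgGm (h2 R))
      (Eventually.of_forall fun _ => hψ.continuous_gradient.aestronglyMeasurable)
      (Eventually.of_forall fun _ => hC₁) (fun _ => tendsto_const_nhds)
    have hset : ∀ g : E3 → E3, ∫ x, ⟪g x, gradient ψ x⟫ ∂μ = ∫ x, ⟪g x, gradient ψ x⟫ :=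
      fun g => setIntegral_eq_integral_of_forall_compl_eq_zero fun x hx => by
        rw [hgψ0 x hx, inner_zero_right]
    simpa only [hset] using this
  -- the potential term
  have hII : Tendsto (fun e => ∫ x, V e x * v e x * ψ x) l (𝓝 (∫ x, c * U x * ψ x)) := by
    have := tendsto_integral_inner (w := fun e x => V e x * ψ x) (w₀ := fun x => c * ψ x)
      (C := M * C₀) hvm (hU6.integrable (by norm_num))
      (tendsto_eLpNorm_of_exponent_le one_ne_zero (by norm_num) hvUm (h6 R))
      (Eventually.of_forall fun e => ((hVc e).mul hψ.1.continuous).aestronglyMeasurable)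
      (Eventually.of_forall fun e x => by
        rw [norm_mul]
        exact mul_le_mul (hVM e x) (hC₀ x) (norm_nonneg _) ((abs_nonneg _).trans (hVM e x)))
      (fun x => (hVl x).mul_const _)
    have hset : ∀ g w : E3 → ℝ, ∫ x, ⟪g x, w x * ψ x⟫ ∂μ = ∫ x, w x * g x * ψ x := fun g w => by
      rw [setIntegral_eq_integral_of_forall_compl_eq_zero fun x hx => by
        rw [hψ0 x hx, mul_zero, inner_zero_right]]
      congr 1; ext1 x
      rw [real_inner_eq_mul]
      ring
    have hset' := fun g => hset g (fun _ => c)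
    simpa only [hset, hset'] using this
  -- the nonlinear term
  have hIII : Tendsto (fun e => ∫ x, v e x ^ p * ψ x) l (𝓝 (∫ x, U x ^ p * ψ x)) := by
    have hUp : MemLp U (ENNReal.ofReal p) μ := hU6.mono_exponent hp6'
    have hUi := hUp.integrable_norm_rpow (by simp; linarith) ENNReal.ofReal_ne_top
    rw [ENNReal.toReal_ofReal (by linarith)] at hUi
    have := tendsto_integral_inner (w := fun _ : ι => ψ) (w₀ := ψ) (C := C₀)
      (hvm.mono fun e he => (he.norm.aemeasurable.pow_const p).aestronglyMeasurable) hUi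
      (tendsto_eLpNorm_norm_rpow_sub hp hvm hUp
        (tendsto_eLpNorm_of_exponent_le (by simp; linarith) hp6' hvUm (h6 R)))
      (Eventually.of_forall fun _ => hψ.1.continuous.aestronglyMeasurable)
      (Eventually.of_forall fun _ => hC₀) (fun _ => tendsto_const_nhds)
    have hset : ∀ w : E3 → ℝ, (∀ᵐ x, 0 < w x) →
        ∫ x, ⟪‖w x‖ ^ p, ψ x⟫ ∂μ = ∫ x, w x ^ p * ψ x := fun w hw => by
      rw [setIntegral_eq_integral_of_forall_compl_eq_zero fun x hx => by
        rw [hψ0 x hx, inner_zero_right]]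
      refine integral_congr_ae (hw.mono fun x hx => ?_)
      simp only [real_inner_eq_mul, Real.norm_of_nonneg hx.le]
    rw [hset U hU.pos] at this
    exact this.congr' (hv.mono fun e he => hset _ he.pos)
  -- the equation for `v e`, solved for the energy in its coefficient
  have hquot : Tendsto (fun e => b⁻¹ * (((∫ x, v e x ^ p * ψ x) - ∫ x, V e x * v e x * ψ x) /
      (∫ x, ⟪weakGrad (v e) x, gradient ψ x⟫) - a)) l
      (𝓝 (b⁻¹ * (((∫ x, U x ^ p * ψ x) - ∫ x, c * U x * ψ x) /
      (∫ x, ⟪weakGrad U x, gradient ψ x⟫) - a))) :=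
    (((hIII.sub hII).div hI hne).sub_const a).const_mul _
  have hsolve : ∀ {W w : E3 → ℝ}, IsPositiveSolution a b p 1 W w →
      ∫ x, ⟪weakGrad w x, gradient ψ x⟫ ≠ 0 →
      b⁻¹ * (((∫ x, w x ^ p * ψ x) - ∫ x, W x * w x * ψ x) /
      (∫ x, ⟪weakGrad w x, gradient ψ x⟫) - a) = ∫ x, ‖weakGrad w x‖ ^ 2 := fun hw hne => by
    rw [← hw.eqn ψ hψ]
    field_simp
    ring
  rw [hsolve hU hne] at hquot
  refine hquot.congr' ?_
  filter_upwards [hv, hI.eventually_ne hne] with e he hee using hsolve he hee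

/-- Local convergence of gradients in `L²` gives convergence of the energy in each ball. -/
theorem tendsto_local_energy {ι : Type*} {l : Filter ι} [l.IsCountablyGenerated]
    {R : ℝ} {G : E3 → E3} {g : ι → E3 → E3}
    (hG : MemLp G 2) (hg : ∀ᶠ e in l, MemLp (g e) 2)
    (h : Tendsto (fun e => eLpNorm (fun z => g e z - G z) 2
      (volume.restrict (Metric.ball 0 R))) l (𝓝 0)) :
    Tendsto (fun e => ∫ x in Metric.ball 0 R, ‖g e x‖ ^ 2) l
      (𝓝 (∫ x in Metric.ball 0 R, ‖G x‖ ^ 2)) := by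
  have hGR := hG.restrict (Metric.ball 0 R)
  have e2 : ENNReal.ofReal 2 = 2 := by simp
  have := tendsto_eLpNorm_norm_rpow_sub one_lt_two (f := g) (F := G)
    (μ := volume.restrict (Metric.ball 0 R))
    (hg.mono fun e he => he.1.restrict) (by rwa [e2]) (by rwa [e2])
  simp only [Real.rpow_two] at this
  exact tendsto_integral_of_L1' _ (hGR.integrable_norm_pow two_ne_zero).1
    (hg.mono fun e he => (he.restrict _).integrable_norm_pow two_ne_zero) this

/-! ### Convergence to the profiles and the contradiction -/

theorem MemLp.eLpNorm_two_eq {G : Type*} [NormedAddCommGroup G] {g : E3 → G} (hg : MemLp g 2) :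
    eLpNorm g 2 = ENNReal.ofReal √(∫ x, ‖g x‖ ^ 2) := by
  rw [hg.eLpNorm_eq_integral_rpow_norm two_ne_zero ENNReal.ofNat_ne_top, Real.sqrt_eq_rpow]
  simp

/-- The remainder, seen at scale `ε`, has vanishing gradient in `L²`. -/
theorem tendsto_rescaled_remainder {a m M : ℝ} (ha : 0 < a) (hm : 0 < m) {V : E3 → ℝ}
    (hVc : Continuous V) (hVm : ∀ x, m ≤ V x) (hVM : ∀ x, V x ≤ M) {S : Set ℝ}
    (hS : S ⊆ Set.Ioi 0) {φ : ℝ → E3 → ℝ} (hφ : ∀ᶠ ε in 𝓝[S] 0, MemH1 (φ ε))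
    (ho : (fun ε => epsNorm a ε V (φ ε)) =o[𝓝[S] 0] (fun ε => ε ^ (3 / 2 : ℝ))) (y : ℝ → E3) :
    Tendsto (fun ε => eLpNorm (fun z => ε • weakGrad (φ ε) (ε • z + y ε)) 2) (𝓝[S] 0) (𝓝 0) := by
  have hlim : Tendsto (fun ε => ENNReal.ofReal
      (√((epsNorm a ε V (φ ε) / ε ^ (3 / 2 : ℝ)) ^ 2 / a))) (𝓝[S] 0) (𝓝 0) := by
    have h1 := ((ho.tendsto_div_nhds_zero.pow 2).div_const a).sqrt
    simpa using ENNReal.tendsto_ofReal h1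
  refine tendsto_of_tendsto_of_tendsto_of_le_of_le' tendsto_const_nhds hlim
    (Eventually.of_forall fun _ => zero_le) ?_
  filter_upwards [hφ, self_mem_nhdsWithin] with ε hε hεS
  have hε0 : 0 < ε := hS hεS
  have hH := hε.isH1Grad.comp_affine hε0 (y ε)
  rw [MemLp.eLpNorm_two_eq hH.memLp_grad]
  refine ENNReal.ofReal_le_ofReal (Real.sqrt_le_sqrt ?_)
  have e1 : ∫ z, ‖ε • weakGrad (φ ε) (ε • z + y ε)‖ ^ 2 = ε⁻¹ * ∫ x, ‖weakGrad (φ ε) x‖ ^ 2 := by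
    rw [← hε.integral_weakGrad_rescale hε0 (y ε)]
    exact integral_congr_ae ((hε.weakGrad_rescale hε0 (y ε)).mono fun z hz => by
      simp only [hz])
  have e2 : (ε ^ (3 / 2 : ℝ)) ^ 2 = ε ^ 3 := by
    rw [← Real.rpow_natCast, ← Real.rpow_mul hε0.le, ← Real.rpow_natCast]
    norm_num
  have hV0 : ∀ x, 0 ≤ V x * φ ε x ^ 2 := fun x =>
    mul_nonneg (hm.le.trans (hVm x)) (sq_nonneg _)
  have hi1 : Integrable (fun x => ε ^ 2 * a * ‖weakGrad (φ ε) x‖ ^ 2) :=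
    hε.integrable_weakGrad_sq.const_mul _
  have hi2 : Integrable (fun x => V x * φ ε x ^ 2) :=
    hε.1.integrable_sq.bdd_mul (c := M) hVc.aestronglyMeasurable (Eventually.of_forall fun x => by
      rw [Real.norm_of_nonneg (hm.le.trans (hVm x))]; exact hVM x)
  have hE : ε ^ 2 * a * ∫ x, ‖weakGrad (φ ε) x‖ ^ 2 ≤ epsNorm a ε V (φ ε) ^ 2 := by
    rw [epsNorm, Real.sq_sqrt (integral_nonneg fun x => add_nonneg (by positivity) (hV0 x)),
      integral_add hi1 hi2, integral_const_mul]
    exact le_add_of_nonneg_right (integral_nonneg hV0)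
  rw [e1, div_pow, e2, le_div_iff₀ ha, le_div_iff₀ (by positivity)]
  refine le_trans (le_of_eq ?_) hE
  field_simp

/-- Centres with distinct limits separate at scale `ε`. -/
theorem tendsto_rescaled_sub_cobounded {S : Set ℝ} (hS : S ⊆ Set.Ioi 0) {y y' : ℝ → E3}
    {c c' : E3} (hy : Tendsto y (𝓝[S] 0) (𝓝 c)) (hy' : Tendsto y' (𝓝[S] 0) (𝓝 c'))
    (hne : c ≠ c') :
    Tendsto (fun ε => ε⁻¹ • (y ε - y' ε)) (𝓝[S] 0) (Bornology.cobounded E3) := by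
  rw [← tendsto_norm_atTop_iff_cobounded]
  have h1 : Tendsto (fun ε : ℝ => ε⁻¹) (𝓝[S] 0) atTop :=
    tendsto_inv_nhdsGT_zero.mono_left (nhdsWithin_mono _ hS)
  refine (h1.atTop_mul_pos (norm_pos_iff.2 (sub_ne_zero.2 hne)) (hy.sub hy').norm).congr' ?_
  filter_upwards [self_mem_nhdsWithin] with ε hε
  rw [norm_smul, norm_inv, Real.norm_of_nonneg (le_of_lt (hS hε))]

/-- Two balls of radius `R` in rescaled coordinates around separating centres are eventually
disjoint, so that the local energies add up to at most the total energy. -/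
theorem eventually_local_energy_add_le {S : Set ℝ} (hS : S ⊆ Set.Ioi 0) {y y' : ℝ → E3}
    {c c' : E3} (hy : Tendsto y (𝓝[S] 0) (𝓝 c)) (hy' : Tendsto y' (𝓝[S] 0) (𝓝 c'))
    (hne : c ≠ c') {u : ℝ → E3 → ℝ} (hu : ∀ᶠ ε in 𝓝[S] 0, MemH1 (u ε)) (R : ℝ) :
    ∀ᶠ ε in 𝓝[S] 0,
      (∫ z in Metric.ball 0 R, ‖weakGrad (fun z => u ε (ε • z + y ε)) z‖ ^ 2) +
      (∫ z in Metric.ball 0 R, ‖weakGrad (fun z => u ε (ε • z + y' ε)) z‖ ^ 2) ≤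
      ∫ z, ‖weakGrad (fun z => u ε (ε • z + y ε)) z‖ ^ 2 := by
  have hfar := (tendsto_norm_cobounded_atTop.comp
    (tendsto_rescaled_sub_cobounded hS hy hy' hne)).eventually_ge_atTop (R + R)
  filter_upwards [hu, self_mem_nhdsWithin, hfar] with ε hε hεS hd
  have hε0 : 0 < ε := hS hεS
  have hdisj : Disjoint (Metric.ball (y ε) (ε * R)) (Metric.ball (y' ε) (ε * R)) := by
    refine Metric.ball_disjoint_ball ?_
    rw [Function.comp_apply, norm_smul, norm_inv, Real.norm_of_nonneg hε0.le,
      le_inv_mul_iff₀ hε0, mul_add] at hd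
    rwa [dist_eq_norm]
  have hint := hε.integrable_weakGrad_sq
  rw [hε.setIntegral_weakGrad_rescale hε0, hε.setIntegral_weakGrad_rescale hε0,
    hε.integral_weakGrad_rescale hε0, ← mul_add,
    ← setIntegral_union hdisj Metric.isOpen_ball.measurableSet hint.integrableOn hint.integrableOn]
  exact mul_le_mul_of_nonneg_left (setIntegral_le_integral hint
    (Eventually.of_forall fun x => sq_nonneg _)) (inv_nonneg.2 hε0.le)

theorem IsH1Grad.translate {u : E3 → ℝ} {g : E3 → E3} (h : IsH1Grad u g) (s : E3) :
    IsH1Grad (fun z => u (z + s)) (fun z => g (z + s)) := by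
  simpa using h.comp_affine one_pos s

/-- Around the `i`-th centre, at scale `ε`, the family converges to the profile `U i`: locally in
`L⁶`, with gradients converging locally in `L²`. -/
theorem tendsto_profile {a m M : ℝ} (ha : 0 < a) (hm : 0 < m) {V : E3 → ℝ}
    (hVc : Continuous V) (hVm : ∀ x, m ≤ V x) (hVM : ∀ x, V x ≤ M) {S : Set ℝ}
    (hS : S ⊆ Set.Ioi 0) {k : ℕ} {pt : Fin k → E3} (hpt : Function.Injective pt)
    {U : Fin k → E3 → ℝ} (hU : ∀ i, MemH1 (U i)) {u : ℝ → E3 → ℝ}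
    {y : ℝ → Fin k → E3} {φ : ℝ → E3 → ℝ}
    (hu : ∀ᶠ ε in 𝓝[S] 0, ∀ᵐ x, u ε x = (∑ i, U i (ε⁻¹ • (x - y ε i))) + φ ε x)
    (hφ : ∀ᶠ ε in 𝓝[S] 0, MemH1 (φ ε))
    (ho : (fun ε => epsNorm a ε V (φ ε)) =o[𝓝[S] 0] (fun ε => ε ^ (3 / 2 : ℝ)))
    (hy : ∀ i, Tendsto (fun ε => y ε i) (𝓝[S] 0) (𝓝 (pt i))) (i : Fin k) (R : ℝ) :
    Tendsto (fun ε => eLpNorm (fun z => u ε (ε • z + y ε i) - U i z) 6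
      (volume.restrict (Metric.ball 0 R))) (𝓝[S] 0) (𝓝 0) ∧
    Tendsto (fun ε => eLpNorm (fun z => weakGrad (fun z => u ε (ε • z + y ε i)) z -
      weakGrad (U i) z) 2 (volume.restrict (Metric.ball 0 R))) (𝓝[S] 0) (𝓝 0) := by
  set s : Fin k → ℝ → E3 := fun j ε => ε⁻¹ • (y ε i - y ε j)
  have hsi : ∀ ε, s i ε = 0 := fun ε => by simp [s]
  have hs : ∀ j ≠ i, Tendsto (s j) (𝓝[S] 0) (Bornology.cobounded E3) := fun j hj =>
    tendsto_rescaled_sub_cobounded hS (hy i) (hy j) (hpt.ne hj.symm)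
  have hpos : ∀ᶠ ε in 𝓝[S] 0, 0 < ε := by
    filter_upwards [self_mem_nhdsWithin] with ε hε using hS hε
  have hrem : ∀ᶠ ε in 𝓝[S] 0, IsH1Grad (fun z => φ ε (ε • z + y ε i))
      (fun z => ε • weakGrad (φ ε) (ε • z + y ε i)) := by
    filter_upwards [hφ, hpos] with ε hε hε0 using hε.isH1Grad.comp_affine hε0 _
  have hgrad := tendsto_rescaled_remainder ha hm hVc hVm hVM hS hφ ho (fun ε => y ε i)
  have hdec : ∀ᶠ ε in 𝓝[S] 0, (fun z => u ε (ε • z + y ε i)) =ᵐ[volume]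
      fun z => (∑ j, U j (z + s j ε)) + φ ε (ε • z + y ε i) := by
    filter_upwards [hu, hpos] with ε hε hε0
    refine (ae_comp_affine hε0 (y ε i) hε).mono fun z hz => ?_
    simp only [hz]
    congr 1
    refine Finset.sum_congr rfl fun j _ => ?_
    congr 1
    rw [add_sub_assoc, smul_add, smul_smul, inv_mul_cancel₀ hε0.ne', one_smul]
  refine ⟨?_, ?_⟩
  · refine tendsto_eLpNorm_sub_profile (by norm_num) ENNReal.ofNat_ne_top
      (fun j => (hU j).isH1Grad.memLp_six) hsi hs (hrem.mono fun ε hε => hε.memLp.1) ?_ hdec R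
    refine tendsto_of_tendsto_of_tendsto_of_le_of_le' tendsto_const_nhds ?_
      (Eventually.of_forall fun _ => zero_le) (hrem.mono fun ε hε => hε.eLpNorm_six_le)
    simpa using ENNReal.Tendsto.const_mul hgrad (Or.inr ENNReal.coe_ne_top)
  · refine tendsto_eLpNorm_sub_profile one_le_two ENNReal.ofNat_ne_top
      (fun j => (hU j).isH1Grad.memLp_grad) hsi hs (hrem.mono fun ε hε => hε.memLp_grad.1) hgrad ?_ R
    filter_upwards [hdec, hrem] with ε hε hr
    exact (((IsH1Grad.sum Finset.univ fun j _ => (hU j).isH1Grad.translate (s j ε)).add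
      hr).congr hε.symm .rfl).weakGrad_ae_eq

end Kirchhoff

theorem proposition2p2 (a b p : ℝ) (ha : 0 < a) (hb : 0 < b) (hp₁ : 1 < p) (hp₅ : p < 5)
    (V : Kirchhoff.E3 → ℝ) (hVc : Continuous V)
    (hVinf : ∃ m > 0, ∀ x, m ≤ V x) (hVsup : ∃ M, ∀ x, V x ≤ M)
    (k : ℕ) (hk : 2 ≤ k)
    (pt : Fin k → Kirchhoff.E3) (hpt : Function.Injective pt)
    (U : Fin k → Kirchhoff.E3 → ℝ)
    (hU : ∀ i, Kirchhoff.IsPositiveSolution a b p 1 (fun _ => V (pt i)) (U i))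
    (S : Set ℝ) (hS : S ⊆ Set.Ioi 0) (hS0 : (0 : ℝ) ∈ closure S) :
    ¬ ∃ u : ℝ → Kirchhoff.E3 → ℝ,
        Kirchhoff.IsMultiPeakSolution k a b p V S u ∧
        Kirchhoff.HasPeakForm a V S pt U u := by
  rintro ⟨u, ⟨hsol, -, -⟩, y, φ, hu, hφ, ho, hy⟩
  obtain ⟨m, hm, hVm⟩ := hVinf
  obtain ⟨M, hVM⟩ := hVsup
  have : (𝓝[S] (0 : ℝ)).NeBot := mem_closure_iff_nhdsWithin_neBot.1 hS0
  have hpos : ∀ᶠ ε in 𝓝[S] (0 : ℝ), 0 < ε := by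
    filter_upwards [self_mem_nhdsWithin] with ε hε using hS hε
  have hprof := Kirchhoff.tendsto_profile ha hm hVc hVm hVM hS hpt (fun i => (hU i).memH1)
    hu hφ ho hy
  have hresc : ∀ i, ∀ᶠ ε in 𝓝[S] 0, Kirchhoff.IsPositiveSolution a b p 1
      (fun z => V (ε • z + y ε i)) (fun z => u ε (ε • z + y ε i)) := fun i => by
    filter_upwards [hsol, hpos] with ε hε hε0 using hε.rescale hε0 _
  let i : Fin k := ⟨0, by omega⟩
  let j : Fin k := ⟨1, by omega⟩
  have hij : i ≠ j := by simp [i, j]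
  have hV0 : ∀ x, 0 < V x := fun x => hm.trans_le (hVm x)
  have henergy := Kirchhoff.tendsto_energy (M := M) hb hp₁ (by linarith) (hV0 (pt i)) (hU i)
    (hresc i) (fun ε => hVc.comp (by fun_prop))
    (fun ε x => by rw [abs_of_pos (hV0 _)]; exact hVM _)
    (fun x => by
      have h0 : Tendsto (fun ε : ℝ => ε • x + y ε i) (𝓝[S] 0) (𝓝 ((0 : ℝ) • x + pt i)) :=
        (((tendsto_id (x := 𝓝 (0 : ℝ))).mono_left nhdsWithin_le_nhds).smul_const x).add (hy i)
      rw [zero_smul, zero_add] at h0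
      exact (hVc.tendsto _).comp h0)
    (fun R => (hprof i R).1) (fun R => (hprof i R).2)
  have hloc : ∀ i R, Tendsto (fun ε => ∫ z in Metric.ball 0 R,
      ‖Kirchhoff.weakGrad (fun z => u ε (ε • z + y ε i)) z‖ ^ 2) (𝓝[S] 0)
      (𝓝 (∫ z in Metric.ball 0 R, ‖Kirchhoff.weakGrad (U i) z‖ ^ 2)) := fun i R =>
    Kirchhoff.tendsto_local_energy (hU i).memH1.isH1Grad.memLp_grad
      ((hresc i).mono fun ε hε => hε.memH1.isH1Grad.memLp_grad) (hprof i R).2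
  have hle : ∀ R, (∫ z in Metric.ball 0 R, ‖Kirchhoff.weakGrad (U i) z‖ ^ 2) +
      (∫ z in Metric.ball 0 R, ‖Kirchhoff.weakGrad (U j) z‖ ^ 2) ≤
      ∫ z, ‖Kirchhoff.weakGrad (U i) z‖ ^ 2 := fun R =>
    le_of_tendsto_of_tendsto ((hloc i R).add (hloc j R)) henergy
      (Kirchhoff.eventually_local_energy_add_le hS (hy i) (hy j) (hpt.ne hij)
        (hsol.mono fun ε hε => hε.memH1) R)
  -- exhausting space by balls, the energy of `U i` dominates itself plus that of `U j`
  have hexh : ∀ i, Tendsto (fun n : ℕ => ∫ z in Metric.ball 0 (n : ℝ),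
      ‖Kirchhoff.weakGrad (U i) z‖ ^ 2) atTop (𝓝 (∫ z, ‖Kirchhoff.weakGrad (U i) z‖ ^ 2)) := by
    intro i
    have := tendsto_setIntegral_of_monotone (μ := volume)
      (s := fun n : ℕ => Metric.ball (0 : Kirchhoff.E3) n)
      (fun n => Metric.isOpen_ball.measurableSet)
      (fun n n' h => Metric.ball_subset_ball (by exact_mod_cast h))
      (hU i).memH1.integrable_weakGrad_sq.integrableOn
    rwa [Metric.iUnion_ball_nat, Measure.restrict_univ] at this
  have hsum := le_of_tendsto' ((hexh i).add (hexh j)) fun n => hle n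
  have hj0 : ∫ z, ‖Kirchhoff.weakGrad (U j) z‖ ^ 2 = 0 :=
    le_antisymm (by linarith) (integral_nonneg fun z => sq_nonneg _)
  rw [integral_eq_zero_iff_of_nonneg (fun z => sq_nonneg _)
    (hU j).memH1.integrable_weakGrad_sq] at hj0
  obtain ⟨ψ, -, hne⟩ := (hU j).exists_integral_inner_ne_zero (hV0 (pt j)) hp₁ (by linarith)
  refine hne ?_
  rw [integral_congr_ae (g := fun _ => (0 : ℝ)) (hj0.mono fun z hz => ?_), integral_zero]
  have : Kirchhoff.weakGrad (U j) z = 0 := by simpa using hz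
  simp only [this, inner_zero_left]
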